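/- **Setting.** Let $V$ be a finite set, $E=\binom V2$ the set of unordered pairs of distinct elements of $V$, $m=|E|$, and let $\mathrm s:E\to[0,1]$ be an unknown similarity function. The cost of a clustering (a partition) $\mathcal C$ of $V$ is $$\mathrm{cost}_{\mathrm s}(\mathcal C)=\sum_{e\in E \text{ inside a cluster of } \mathcal C}(1-\mathrm s(e))+\sum_{e\in E\text{ separated by }\mathcal C}\mathrm s(e),\qquad \mathrm{OPT}(\mathrm s)=\min_{\mathcal C}\mathrm{cost}_{\mathrm s}(\mathcal C).$$ Each query of a pair $e$ to a noisy oracle returns a random value in $[0,1]$ with mean $\mathrm s(e)$ (for instance a Bernoulli variable); all answers are independent. **TB-HS** with accuracy $\epsilon'\in(0,\tfrac12)$ and confidence $\delta\in(0,1)$ starts with $\widehat G=\widehat B=\emptyset$. While $\widehat G\cup\widehat B\ne E$, it selects a pair $e\in E\setminus(\widehat G\cup\widehat B)$ by an arbitrary rule depending on the history, and queries it. If $e$ has now been queried $k$ times, with empirical mean $\widehat{\mathrm s}_{e,k}$, and $\mathrm{rad}_k=\sqrt{\log(4mk^2/\delta)/(2k)}$, then $e$ is added to $\widehat G$ if $\widehat{\mathrm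 s}_{e,k}-\mathrm{rad}_k\ge\frac12-\epsilon'$, and otherwise to $\widehat B$ if $\widehat{\mathrm s}_{e,k}+\mathrm{rad}_k\le\frac12+\epsilon'$. **KC-FC** with parameters $\epsilon,\delta$ runs TB-HS with accuracy $\epsilon'=\epsilon/(12m)$ and confidence $\delta$, and then runs KwikCluster on the result: starting from $R=V$, as long as $R\neq\emptyset$ it draws a pivot $p\in R$ uniformly at random, outputs the cluster $\{p\}\cup\{u\in R:\{p,u\}\in\widehat G\}$ and removes it from $R$. Let $\mathcal C_{\mathrm{out}}$ be the resulting clustering and $T\in\mathbb N\cup\{\infty\}$ the number of oracle queries made. **Gaps.** Put $\Delta_e=|\mathrm s(e)-\tfrac12|$, $\Delta_{\min}=\min_{e\in E}\Delta_e$, $\tilde\Delta_{e,\epsilon'}=\Delta_e+\min\{\epsilon'-\Delta_{\min},\ \epsilon'/2\}$, and $$H=\sum_{e\in E}\frac1{\tilde\Delta_{e,\epsilon'}^2}\log\left(\frac{\sqrt{m/\delta}}{\tilde\Delta_{e,\epsilon'}^2}\log\left(\frac{\sqrt{m/\delta}}{\tilde\Delta_{e,\epsilon'}^2}\right)\right)+\frac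 m{\max\{\Delta_{\min},\epsilon'/2\}^2}.$$ **Theorem.** There is an absolute constant $K>0$ such that for all $V$, $\mathrm s$, all $\delta\in(0,1)$, all $\epsilon>0$ with $\epsilon'=\epsilon/(12m)<\frac12$ (that is, $0<\epsilon<6m$), and every selection rule: 1. with probability at least $1-\delta$ over the answers of the oracle, both $$\mathbb E[\mathrm{cost}_{\mathrm s}(\mathcal C_{\mathrm{out}})]\le 5\cdot\mathrm{OPT}(\mathrm s)+\epsilon\qquad\text{and}\qquad T\le K\cdot H$$ hold, where the expectation is over the random pivots of KwikCluster; 2. $\mathbb E[T]\le K\cdot H$. -/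

import Mathlib

open MeasureTheory ProbabilityTheory
open scoped ENNReal

universe u v

noncomputable section

namespace CorrClust

/-! ### The offline problem -/

/-- The set `E` of unordered pairs of distinct objects (the arms). -/
abbrev Pair (V : Type*) : Type _ := {e : Sym2 V // ¬ e.IsDiag}

/-- The number `m = |E|` of pairs. -/
def numPairs (V : Type*) [Fintype V] [DecidableEq V] : ℕ := Fintype.card (Pair V)

/-- A clustering of `V`: a partition of `V` into nonempty clusters. -/
abbrev Clustering (V : Type*) [Fintype V] [DecidableEq V] : Type _ :=
  Finpartition (Finset.univ : Finset V)

/-- The two end points of `e` lie in a common cluster. -/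
def SameCluster {V : Type*} [Fintype V] [DecidableEq V] (P : Clustering V) (e : Pair V) : Prop :=
  ∃ C ∈ P.parts, ∀ v ∈ e.1, v ∈ C

open Classical in
/-- The correlation clustering cost: a pair inside a cluster pays its dissimilarity, a pair that
is separated pays its similarity. -/
def cost {V : Type*} [Fintype V] [DecidableEq V] (sim : Pair V → ℝ) (P : Clustering V) : ℝ :=
  ∑ e : Pair V, if SameCluster P e then 1 - sim e else sim e

/-- The minimum cost over all clusterings. -/
def OPT {V : Type*} [Fintype V] [DecidableEq V] (sim : Pair V → ℝ) : ℝ :=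
  ⨅ P : Clustering V, cost sim P

/-- The expected cost of a random clustering. -/
def expectedCost {V : Type*} [Fintype V] [DecidableEq V] (sim : Pair V → ℝ)
    (D : PMF (Clustering V)) : ℝ :=
  ∑ P : Clustering V, (D P).toReal * cost sim P

/-! ### KwikCluster -/

/-- The cluster of the pivot `p` among the remaining objects `R`, where `G` is the set of pairs
that are regarded as similar. -/
def pivotCluster {V : Type*} [DecidableEq V] (G : Finset (Pair V)) (R : Finset V) (p : V) :
    Finset V :=
  insert p (R.filter fun u => ∃ e ∈ G, e.1 = s(p, u))

theorem pivotCluster_ne_bot {V : Type*} [DecidableEq V] (G : Finset (Pair V)) (R : Finset V)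
    (p : V) : pivotCluster G R p ≠ ⊥ :=
  Finset.insert_ne_empty _ _

theorem pivotCluster_subset {V : Type*} [DecidableEq V] (G : Finset (Pair V)) (R : Finset V)
    (p : V) (hp : p ∈ R) : pivotCluster G R p ⊆ R :=
  Finset.insert_subset hp (Finset.filter_subset _ _)

theorem card_sdiff_pivotCluster_lt {V : Type*} [DecidableEq V] (G : Finset (Pair V))
    (R : Finset V) (p : V) (hp : p ∈ R) : (R \ pivotCluster G R p).card < R.card :=
  Finset.card_lt_card (Finset.sdiff_ssubset (pivotCluster_subset G R p hp)
    ⟨p, Finset.mem_insert_self _ _⟩)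

/-- KwikCluster on the remaining objects `R`: draw a pivot uniformly at random from `R`, output its
cluster, remove it, and go on with the rest until no object remains. The result is the law of the
clustering of `R` that is produced. -/
def kwikCluster {V : Type*} [DecidableEq V] (G : Finset (Pair V)) (R : Finset V) :
    PMF (Finpartition R) :=
  if h : R.Nonempty then
    haveI : Nonempty {x // x ∈ R} := h.to_subtype
    (PMF.uniformOfFintype {x // x ∈ R}).bind fun p =>
      (kwikCluster G (R \ pivotCluster G R p.1)).map fun P =>
        P.extend (pivotCluster_ne_bot G R p.1) Finset.sdiff_disjoint
          (Finset.sdiff_union_of_subset (pivotCluster_subset G R p.1 p.2))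
  else
    PMF.pure ((Finpartition.empty (Finset V)).copy (Finset.not_nonempty_iff_eq_empty.mp h).symm)
termination_by R.card
decreasing_by exact card_sdiff_pivotCluster_lt G R p.1 p.2

/-! ### TB-HS

A pair is undecided as long as it is neither in `good` nor in `bad`. In each round one undecided
pair is selected and queried, and then its empirical mean is compared with the threshold `1/2`. -/

/-- A rule that selects the undecided pair to be queried next from the history of the
queried pairs and the feedback received (latest entry first). -/
structure SamplingRule (V : Type*) where
  select : List (Pair V × ℝ) → Finset (Pair V) → Pair V
  select_mem : ∀ (h : List (Pair V × ℝ)) (A : Finset (Pair V)), A.Nonempty → select h A ∈ A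

/-- The state of TB-HS: history, number of queries and sum of the feedback for each pair, and the
pairs decided so far. -/
structure State (V : Type*) where
  history : List (Pair V × ℝ)
  count : Pair V → ℕ
  total : Pair V → ℝ
  good : Finset (Pair V)
  bad : Finset (Pair V)

/-- The state before the first query. -/
def State.init (V : Type*) : State V := ⟨[], fun _ => 0, fun _ => 0, ∅, ∅⟩

/-- The pairs that are neither in `good` nor in `bad`. -/
def State.undecided {V : Type*} [Fintype V] [DecidableEq V] (S : State V) : Finset (Pair V) :=
  Finset.univ \ (S.good ∪ S.bad)

/-- The empirical mean of the feedback for `e`. -/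
def State.mean {V : Type*} (S : State V) (e : Pair V) : ℝ := S.total e / S.count e

/-- The confidence radius after `k` queries: `√(log(4 m k² / δ) / (2 k))`. -/
def radius (m : ℕ) (δ : ℝ) (k : ℕ) : ℝ :=
  Real.sqrt (Real.log (4 * m * (k : ℝ) ^ 2 / δ) / (2 * k))

/-- Record the feedback `x` for a query of `e`. -/
def State.record {V : Type*} [DecidableEq V] (S : State V) (e : Pair V) (x : ℝ) : State V :=
  { S with
    history := (e, x) :: S.history
    count := Function.update S.count e (S.count e + 1)
    total := Function.update S.total e (S.total e + x) }

/-- Put `e` into `good` if its lower confidence bound is at least `1/2 - ε`; otherwise put it into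
`bad` if its upper confidence bound is at most `1/2 + ε`. -/
def State.classify {V : Type*} [Fintype V] [DecidableEq V] (ε δ : ℝ) (S : State V) (e : Pair V) :
    State V :=
  if 1 / 2 - ε ≤ S.mean e - radius (numPairs V) δ (S.count e) then
    { S with good := insert e S.good }
  else if S.mean e + radius (numPairs V) δ (S.count e) ≤ 1 / 2 + ε then
    { S with bad := insert e S.bad }
  else S

/-- One round. Here `x e k` is the feedback of the oracle to the `(k+1)`-st query of `e`. If no
pair is undecided, the algorithm has stopped and nothing is queried. -/
def tbhsStep {V : Type*} [Fintype V] [DecidableEq V] (ε δ : ℝ) (rule : SamplingRule V)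
    (x : Pair V → ℕ → ℝ) (S : State V) : State V :=
  if S.undecided.Nonempty then
    let e := rule.select S.history S.undecided
    (S.record e (x e (S.count e))).classify ε δ e
  else S

/-- The state of TB-HS with accuracy `ε` and confidence `δ` after `t` rounds. -/
def tbhsRun {V : Type*} [Fintype V] [DecidableEq V] (ε δ : ℝ) (rule : SamplingRule V)
    (x : Pair V → ℕ → ℝ) : ℕ → State V
  | 0 => State.init V
  | t + 1 => tbhsStep ε δ rule x (tbhsRun ε δ rule x t)

/-- The number of queries made by TB-HS: the first round after which every pair is decided, and `⊤`
if there is none. -/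
def tbhsQueries {V : Type*} [Fintype V] [DecidableEq V] (ε δ : ℝ) (rule : SamplingRule V)
    (x : Pair V → ℕ → ℝ) : ℕ∞ :=
  ⨅ (t : ℕ) (_ : (tbhsRun ε δ rule x t).undecided = ∅), (t : ℕ∞)

/-- The set of pairs declared good by TB-HS when it stops (of no significance if it never stops). -/
def tbhsGood {V : Type*} [Fintype V] [DecidableEq V] (ε δ : ℝ) (rule : SamplingRule V)
    (x : Pair V → ℕ → ℝ) : Finset (Pair V) :=
  (tbhsRun ε δ rule x (tbhsQueries ε δ rule x).toNat).good

/-! ### KC-FC -/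

/-- The accuracy `ε' = ε / (12 m)` with which KC-FC calls TB-HS. -/
def accuracy (V : Type*) [Fintype V] [DecidableEq V] (ε : ℝ) : ℝ := ε / (12 * numPairs V)

/-- The law, over the random pivots, of the output clustering of KC-FC for given feedback `x` of
the oracle: TB-HS with accuracy `ε'` and confidence `δ`, followed by KwikCluster. -/
def kcfc {V : Type*} [Fintype V] [DecidableEq V] (ε δ : ℝ) (rule : SamplingRule V)
    (x : Pair V → ℕ → ℝ) : PMF (Clustering V) :=
  kwikCluster (tbhsGood (accuracy V ε) δ rule x) Finset.univ

/-- The number of oracle queries made by KC-FC; KwikCluster itself makes none. -/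
def kcfcQueries {V : Type*} [Fintype V] [DecidableEq V] (ε δ : ℝ) (rule : SamplingRule V)
    (x : Pair V → ℕ → ℝ) : ℕ∞ :=
  tbhsQueries (accuracy V ε) δ rule x

/-! ### Gaps and the sample complexity bound -/

/-- The gap `Δ_e = |s(e) - 1/2|`. -/
def gap {V : Type*} (sim : Pair V → ℝ) (e : Pair V) : ℝ := |sim e - 1 / 2|

/-- The minimum gap `Δ_min`. -/
def gapMin {V : Type*} (sim : Pair V → ℝ) : ℝ := ⨅ e : Pair V, gap sim e

/-- The modified gap `Δ_e + min {ε - Δ_min, ε / 2}`. -/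
def gapTilde {V : Type*} (sim : Pair V → ℝ) (ε : ℝ) (e : Pair V) : ℝ :=
  gap sim e + min (ε - gapMin sim) (ε / 2)

/-- The expression inside the `O(·)` of the sample complexity of TB-HS with accuracy `ε` and
confidence `δ`. -/
def sampleBound {V : Type*} [Fintype V] [DecidableEq V] (sim : Pair V → ℝ) (ε δ : ℝ) : ℝ :=
  (∑ e : Pair V, 1 / gapTilde sim ε e ^ 2 *
    Real.log (Real.sqrt (numPairs V / δ) / gapTilde sim ε e ^ 2 *
      Real.log (Real.sqrt (numPairs V / δ) / gapTilde sim ε e ^ 2))) +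
  numPairs V / max (gapMin sim) (ε / 2) ^ 2

/-! ### The noisy oracle -/

/-- `X e k` is the feedback to the `(k+1)`-st query of `e`: all feedback is independent, takes
values in `[0, 1]`, and has mean `sim e` (for instance Bernoulli feedback). -/
structure IsNoisyOracle {V Ω : Type*} [MeasurableSpace Ω] (μ : Measure Ω) (sim : Pair V → ℝ)
    (X : Pair V → ℕ → Ω → ℝ) : Prop where
  measurable : ∀ e k, Measurable (X e k)
  mem_Icc : ∀ e k, ∀ᵐ ω ∂μ, X e k ω ∈ Set.Icc (0 : ℝ) 1
  mean_eq : ∀ e k, ∫ ω, X e k ω ∂μ = sim e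
  indep : iIndepFun (fun i : Pair V × ℕ => X i.1 i.2) μ

end CorrClust

end

/-! The oracle's answers form a fixed table: the k-th query of a pair reads the k-th entry of its
row, whatever was queried before. Everything is proved for a fixed table; probability enters only
through the events that an empirical mean leaves its confidence interval (`deviation`). By
Hoeffding, the k-th such event for a given pair has probability at most δ/(2mk²), so a union bound
over all k and all m pairs costs at most δ.

Queries. A pair that is still unresolved once 2·rad ≤ Δ + η must have a deviating mean
(`radius_le_abs_of_unresolved`). Hence T is at most a deterministic sample size per pair plus the
number of deviations (`tbhsQueries_le_sampleSize`). Without deviations this is the high-probability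
bound. In expectation each pair has at most δ/m ≤ 1 deviations, which gives E[T]. Elementary
estimates of logarithms (`sum_sampleSize_le`) turn the sample sizes into 25·H.

Cost. Without deviations the good pairs have similarity at least 1/2 - η and the others at most 1/2
+ η. Every pair is charged five times its cost in an optimal clustering plus 8η. In a KwikCluster
round the cost of the settled pairs minus their charge, summed over the pivots, is a sum over
triples of vertices, and it is nonpositive on each triple up to rotation (`triangle_charge`).
Induction on the remaining vertices gives 5·OPT + 8mη, and 8mη = 2ε/3 for η = ε/(12m). -/

namespace CorrClust

/-! ### Expectations under finite probability mass functions -/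

theorem sum_toReal_bind {α β : Type*} [Fintype α] [Fintype β] (D : PMF α) (k : α → PMF β)
    (f : β → ℝ) :
    ∑ b, ((D.bind k) b).toReal * f b = ∑ a, (D a).toReal * ∑ b, (k a b).toReal * f b := by
  have h : ∀ b, ((D.bind k) b).toReal = ∑ a, (D a).toReal * (k a b).toReal := by
    intro b
    rw [PMF.bind_apply, tsum_fintype, ENNReal.toReal_sum]
    · simp only [ENNReal.toReal_mul]
    · exact fun a _ => ENNReal.mul_ne_top (D.apply_ne_top a) ((k a).apply_ne_top b)
  simp only [h, Finset.sum_mul, Finset.mul_sum, mul_assoc]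
  exact Finset.sum_comm

theorem sum_toReal_pure {β : Type*} [Fintype β] (b : β) (f : β → ℝ) :
    ∑ c, (PMF.pure b c).toReal * f c = f b := by
  classical
  rw [Finset.sum_eq_single b]
  · simp
  · intro c _ hc
    simp [PMF.pure_apply, hc]
  · simp

theorem sum_toReal_map {α β : Type*} [Fintype α] [Fintype β] (g : α → β) (D : PMF α)
    (f : β → ℝ) :
    ∑ b, ((D.map g) b).toReal * f b = ∑ a, (D a).toReal * f (g a) := by
  rw [← PMF.bind_pure_comp, sum_toReal_bind]
  simp only [Function.comp_apply, sum_toReal_pure]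

theorem sum_toReal_eq_one {α : Type*} [Fintype α] (D : PMF α) : ∑ a, (D a).toReal = 1 := by
  rw [← ENNReal.toReal_sum fun a _ => D.apply_ne_top a, ← tsum_fintype (L := .unconditional _),
    D.tsum_coe, ENNReal.toReal_one]

/-! ### Costs as sums over ordered pairs -/

/-- The similarity of `u` and `v`, extended by `0` to the diagonal. -/
noncomputable def simFun {V : Type*} [DecidableEq V] (sim : Pair V → ℝ) (u v : V) : ℝ :=
  if h : u = v then 0 else sim ⟨s(u, v), by simpa using h⟩

theorem simFun_comm {V : Type*} [DecidableEq V] (sim : Pair V → ℝ) (u v : V) :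
    simFun sim u v = simFun sim v u := by
  unfold simFun
  by_cases h : u = v
  · simp [h]
  · rw [dif_neg h, dif_neg (Ne.symm h)]
    congr 2
    exact Sym2.eq_swap

/-- The cost of `u` and `v` if they are put together (`q`) or separated (`¬ q`). -/
noncomputable def orderedCost {V : Type*} [DecidableEq V] (sim : Pair V → ℝ) (u v : V) (q : Prop)
    [Decidable q] : ℝ :=
  if u = v then 0 else if q then 1 - simFun sim u v else simFun sim u v

/-- The fibre of `(u, v) ↦ s(u, v)` over a non-diagonal pair consists of exactly two ordered pairs,
whence the factor 2. Ordered sums make the rotation argument on triples possible. -/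
theorem sum_pair {V : Type*} [Fintype V] [DecidableEq V] (f : V → V → ℝ) (g : Pair V → ℝ)
    (hdiag : ∀ u, f u u = 0) (hfg : ∀ u v (h : ¬ (s(u, v)).IsDiag), f u v = g ⟨s(u, v), h⟩) :
    ∑ u, ∑ v, f u v = 2 * ∑ e, g e := by
  classical
  have h1 : ∑ u, ∑ v, f u v = ∑ x : V × V with ¬ (s(x.1, x.2)).IsDiag, f x.1 x.2 := by
    rw [← Finset.univ_product_univ, Finset.sum_filter, Finset.sum_product]
    refine Finset.sum_congr rfl fun u _ => Finset.sum_congr rfl fun v _ => ?_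
    by_cases h : u = v
    · simp [h, hdiag]
    · simp [h]
  have h2 : ∑ e : Pair V, g e
      = ∑ z : Sym2 V with ¬ z.IsDiag, if h : ¬ z.IsDiag then g ⟨z, h⟩ else 0 := by
    rw [Finset.sum_subtype _ (p := fun z : Sym2 V => ¬ z.IsDiag) (by simp)]
    exact Finset.sum_congr rfl fun e _ => by rw [dif_pos e.2]
  have h3 : ∀ x ∈ (Finset.univ.filter fun x : V × V => ¬ (s(x.1, x.2)).IsDiag),
      s(x.1, x.2) ∈ (Finset.univ.filter fun z : Sym2 V => ¬ z.IsDiag) := by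
    intro x hx
    simpa using hx
  rw [h1, h2, ← Finset.sum_fiberwise_of_maps_to h3, Finset.mul_sum]
  refine Finset.sum_congr rfl fun z hz => ?_
  induction z using Sym2.inductionOn with
  | hf a b =>
    have hab : ¬ (s(a, b)).IsDiag := (Finset.mem_filter.1 hz).2
    have hne : a ≠ b := by simpa using hab
    have h4 : ({x ∈ (Finset.univ.filter fun x : V × V => ¬ (s(x.1, x.2)).IsDiag) |
        s(x.1, x.2) = s(a, b)} : Finset (V × V)) = {(a, b), (b, a)} := by
      ext ⟨x, y⟩
      simp only [Finset.mem_filter, Finset.mem_univ, true_and, Finset.mem_insert,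
        Finset.mem_singleton, Prod.mk.injEq, Sym2.eq_iff, Sym2.mk_isDiag_iff]
      constructor
      · exact fun h => h.2
      · rintro (⟨rfl, rfl⟩ | ⟨rfl, rfl⟩)
        · exact ⟨hne, .inl ⟨rfl, rfl⟩⟩
        · exact ⟨hne.symm, .inr ⟨rfl, rfl⟩⟩
    have hba : ¬ (s(b, a)).IsDiag := by simpa using hne.symm
    rw [h4, Finset.sum_pair (by simp [hne]), dif_pos hab, hfg a b hab, hfg b a hba, two_mul]
    congr 3
    exact Sym2.eq_swap

open Classical in
theorem sum_orderedCost {V : Type*} [Fintype V] [DecidableEq V] (sim : Pair V → ℝ)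
    (P : Clustering V) :
    ∑ u, ∑ v, orderedCost sim u v (∃ C ∈ P.parts, u ∈ C ∧ v ∈ C) = 2 * cost sim P := by
  unfold cost
  refine sum_pair _ _ (fun u => by simp [orderedCost]) fun u v h => ?_
  have huv : u ≠ v := by simpa using h
  simp only [orderedCost, huv, if_false, SameCluster, Sym2.ball, simFun, dite_false]

/-! ### The expected cost of KwikCluster -/

/-- The pivot `p` or a neighbour of it in `G`. -/
def PivotAdj {V : Type*} (G : Finset (Pair V)) (p u : V) : Prop :=
  u = p ∨ ∃ e ∈ G, e.1 = s(p, u)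

theorem pivotAdj_comm {V : Type*} (G : Finset (Pair V)) (p u : V) :
    PivotAdj G p u ↔ PivotAdj G u p := by
  unfold PivotAdj
  rw [Sym2.eq_swap (a := p), eq_comm]

theorem mem_pivotCluster {V : Type*} [DecidableEq V] (G : Finset (Pair V)) {R : Finset V} {p u : V}
    (hu : u ∈ R) : u ∈ pivotCluster G R p ↔ PivotAdj G p u := by
  simp [pivotCluster, PivotAdj, hu]

open Classical in
/-- The cost of a partition of `R` over the ordered pairs in `R`. -/
noncomputable def costOn {V : Type*} [DecidableEq V] (sim : Pair V → ℝ) (R : Finset V)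
    (P : Finpartition R) : ℝ :=
  ∑ u ∈ R, ∑ v ∈ R, orderedCost sim u v (∃ C ∈ P.parts, u ∈ C ∧ v ∈ C)

open Classical in
/-- The cost over the ordered pairs in `R` that are touched by the cluster of the pivot `p`. -/
noncomputable def pivotCost {V : Type*} [DecidableEq V] (sim : Pair V → ℝ) (G : Finset (Pair V))
    (R : Finset V) (p : V) : ℝ :=
  ∑ u ∈ R, ∑ v ∈ R, if PivotAdj G p u ∨ PivotAdj G p v then
    orderedCost sim u v (PivotAdj G p u ∧ PivotAdj G p v) else 0

theorem sum_sum_sdiff {V : Type*} [DecidableEq V] (R C : Finset V) (f : V → V → ℝ) :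
    ∑ u ∈ R \ C, ∑ v ∈ R \ C, f u v
      = ∑ u ∈ R, ∑ v ∈ R, if u ∈ C ∨ v ∈ C then 0 else f u v := by
  rw [Finset.sdiff_eq_filter, Finset.sum_filter]
  refine Finset.sum_congr rfl fun u _ => ?_
  rw [Finset.sum_filter]
  by_cases hu : u ∈ C
  · simp [hu]
  · simp only [hu, not_false_iff, if_true, false_or]
    refine Finset.sum_congr rfl fun v _ => ?_
    by_cases hv : v ∈ C <;> simp [hv]

/-- An ordered pair either meets the pivot cluster, and then its fate is settled in this round, or
lies wholly in the rest, where the new cluster does not matter. -/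
theorem costOn_extend {V : Type*} [DecidableEq V] (sim : Pair V → ℝ) (G : Finset (Pair V))
    (R : Finset V) (p : V) (hp : p ∈ R) (P : Finpartition (R \ pivotCluster G R p)) :
    costOn sim R (P.extend (pivotCluster_ne_bot G R p) Finset.sdiff_disjoint
      (Finset.sdiff_union_of_subset (pivotCluster_subset G R p hp)))
      = pivotCost sim G R p + costOn sim (R \ pivotCluster G R p) P := by
  classical
  unfold costOn pivotCost
  rw [sum_sum_sdiff, ← Finset.sum_add_distrib]
  refine Finset.sum_congr rfl fun u hu => ?_
  rw [← Finset.sum_add_distrib]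
  refine Finset.sum_congr rfl fun v hv => ?_
  have hsub : ∀ w, w ∈ pivotCluster G R p → ∀ C ∈ P.parts, w ∉ C := fun w hw C hC hwC =>
    (Finset.mem_sdiff.1 (P.le hC hwC)).2 hw
  rw [← mem_pivotCluster G hu, ← mem_pivotCluster G hv]
  simp only [orderedCost, Finpartition.extend_parts, Finset.mem_insert, exists_eq_or_imp]
  by_cases h1 : u ∈ pivotCluster G R p
  · have : ¬ ∃ C ∈ P.parts, u ∈ C ∧ v ∈ C := fun ⟨C, hC, h, _⟩ => hsub u h1 C hC h
    simp [h1, this]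
  · by_cases h2 : v ∈ pivotCluster G R p
    · have : ¬ ∃ C ∈ P.parts, u ∈ C ∧ v ∈ C := fun ⟨C, hC, _, h⟩ => hsub v h2 C hC h
      simp [h1, h2, this]
    · simp [h1, h2]

theorem sum_kwikCluster {V : Type*} [DecidableEq V] (sim : Pair V → ℝ) (G : Finset (Pair V))
    (R : Finset V) (hR : R.Nonempty) :
    ∑ P, (kwikCluster G R P).toReal * costOn sim R P
      = (∑ p ∈ R, (pivotCost sim G R p
          + ∑ P, (kwikCluster G (R \ pivotCluster G R p) P).toReal
              * costOn sim (R \ pivotCluster G R p) P)) / R.card := by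
  have : Nonempty {x // x ∈ R} := hR.to_subtype
  rw [kwikCluster, dif_pos hR, sum_toReal_bind, Finset.sum_div, ← Finset.sum_coe_sort R]
  refine Finset.sum_congr rfl fun p _ => ?_
  rw [sum_toReal_map]
  simp only [costOn_extend sim G R p.1 p.2, mul_add, Finset.sum_add_distrib]
  rw [← Finset.sum_mul, sum_toReal_eq_one, PMF.uniformOfFintype_apply, Fintype.card_coe,
    ENNReal.toReal_inv, ENNReal.toReal_natCast]
  ring

/-- If for each set of remaining objects the cost of a round, summed over the pivots, is at most
the charge `t` of the pairs that are settled in it, then the expected cost is at most the total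
charge. -/
theorem sum_kwikCluster_le {V : Type*} [DecidableEq V] (sim : Pair V → ℝ) (G : Finset (Pair V))
    (t : V → V → ℝ)
    (h : ∀ R : Finset V, ∑ p ∈ R, (pivotCost sim G R p
      + ∑ u ∈ R \ pivotCluster G R p, ∑ v ∈ R \ pivotCluster G R p, t u v)
        ≤ ∑ _p ∈ R, ∑ u ∈ R, ∑ v ∈ R, t u v) (R : Finset V) :
    ∑ P, (kwikCluster G R P).toReal * costOn sim R P ≤ ∑ u ∈ R, ∑ v ∈ R, t u v := by
  induction R using Finset.strongInduction with
  | H R ih =>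
    rcases R.eq_empty_or_nonempty with rfl | hR
    · simp [costOn]
    · rw [sum_kwikCluster sim G R hR, div_le_iff₀ (by exact_mod_cast hR.card_pos)]
      calc _ ≤ ∑ p ∈ R, (pivotCost sim G R p
            + ∑ u ∈ R \ pivotCluster G R p, ∑ v ∈ R \ pivotCluster G R p, t u v) := by
            refine Finset.sum_le_sum fun p hp => add_le_add le_rfl (ih _ ?_)
            exact (Finset.sdiff_ssubset (pivotCluster_subset G R p hp)
              ⟨p, Finset.mem_insert_self _ _⟩)
        _ ≤ _ := h R
        _ = _ := by rw [Finset.sum_const, nsmul_eq_mul, mul_comm]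

/-- Rotating the indices leaves the triple sum unchanged, so three times the sum is a sum of
nonpositive terms. No distinctness is required: degenerate triples are part of the sum. -/
theorem sum_triple_nonpos {V : Type*} (R : Finset V) (F : V → V → V → ℝ)
    (h : ∀ p u v, F p u v + F u v p + F v p u ≤ 0) : ∑ p ∈ R, ∑ u ∈ R, ∑ v ∈ R, F p u v ≤ 0 := by
  have h1 : ∑ p ∈ R, ∑ u ∈ R, ∑ v ∈ R, F u v p = ∑ p ∈ R, ∑ u ∈ R, ∑ v ∈ R, F p u v := by
    rw [Finset.sum_comm]
    exact Finset.sum_congr rfl fun u _ => Finset.sum_comm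
  have h2 : ∑ p ∈ R, ∑ u ∈ R, ∑ v ∈ R, F v p u = ∑ p ∈ R, ∑ u ∈ R, ∑ v ∈ R, F p u v :=
    (Finset.sum_congr rfl fun p _ => Finset.sum_comm).trans Finset.sum_comm
  have h3 : ∑ p ∈ R, ∑ u ∈ R, ∑ v ∈ R, (F p u v + F u v p + F v p u) ≤ 0 :=
    Finset.sum_nonpos fun p _ => Finset.sum_nonpos fun u _ => Finset.sum_nonpos fun v _ => h p u v
  simp only [Finset.sum_add_distrib] at h3
  linarith

open Classical in
/-- The charge of a pair: five times its cost in a reference clustering `O`, and `8 η`. -/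
noncomputable def charge {V : Type*} [DecidableEq V] (sim : Pair V → ℝ) (η : ℝ)
    (O : V → V → Prop) (u v : V) : ℝ :=
  if u = v then 0 else 5 * orderedCost sim u v (O u v) + 8 * η

-- The three terms are the three choices of the pivot inside one triangle. Outside the bad triangles
-- (two good pairs and one not good) each settled pair pays for itself, as its cost is at most its
-- charge. In a bad triangle all three pairs are charged together, using that the reference
-- clustering cannot join exactly two of them. The factor 5 is tight there: with η = 0 and
-- similarities 1, 1, 1/2, where the last pair is not good, the rounds cost 5/2 in total, while a
-- single cluster costs 1/2.
open Classical in
theorem triangle_charge {V : Type*} [DecidableEq V] (sim : Pair V → ℝ)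
    (hsim : ∀ e, sim e ∈ Set.Icc (0 : ℝ) 1) (η : ℝ) (hη : 0 ≤ η) (G : Finset (Pair V))
    (hG : ∀ e ∈ G, 1 / 2 - η ≤ sim e) (hB : ∀ e ∉ G, sim e ≤ 1 / 2 + η)
    (O : V → V → Prop) (hO : Equivalence O)
    (F : V → V → V → ℝ) (hF : F = fun p u v => if PivotAdj G p u ∨ PivotAdj G p v then
      orderedCost sim u v (PivotAdj G p u ∧ PivotAdj G p v) - charge sim η O u v else 0)
    (p u v : V) : F p u v + F u v p + F v p u ≤ 0 := by
  have key : ∀ a b : V, a ≠ b → 0 ≤ simFun sim a b ∧ simFun sim a b ≤ 1 ∧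
      (PivotAdj G a b → 1 / 2 - η ≤ simFun sim a b) ∧
      (¬ PivotAdj G a b → simFun sim a b ≤ 1 / 2 + η) := by
    intro a b hab
    have hd : ¬ (s(a, b)).IsDiag := by simpa using hab
    have hs : simFun sim a b = sim ⟨s(a, b), hd⟩ := by simp [simFun, hab]
    have hadj : PivotAdj G a b ↔ (⟨s(a, b), hd⟩ : Pair V) ∈ G := by
      simp only [PivotAdj, hab.symm, false_or]
      exact ⟨fun ⟨e, he, h⟩ => by convert he; exact h.symm, fun h => ⟨_, h, rfl⟩⟩
    rw [hs, hadj]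
    exact ⟨(hsim _).1, (hsim _).2, hG _, hB _⟩
  have hself : ∀ a, PivotAdj G a a := fun a => .inl rfl
  subst hF
  simp only [charge, orderedCost]
  -- If two of the vertices coincide, only one pair is left, counted twice, and the diagonal term
  -- vanishes.
  by_cases h1 : p = u
  · subst h1
    by_cases h2 : p = v
    · subst h2
      simp
    · obtain ⟨k1, k2, k3, k4⟩ := key p v h2
      have e1 := pivotAdj_comm G v p
      have e2 := simFun_comm sim v p
      have e3 : O v p ↔ O p v := ⟨hO.symm, hO.symm⟩
      simp only [e1, e2, e3, h2, Ne.symm h2, hself, if_false, if_true, true_or, or_true,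
        true_and, and_true]
      by_cases a1 : PivotAdj G p v <;> by_cases o1 : O p v <;> simp only [a1, o1, if_true, if_false,
        not_true, not_false_iff, forall_const, IsEmpty.forall_iff, or_self] at k3 k4 ⊢ <;> linarith
  · by_cases h2 : u = v
    · subst h2
      obtain ⟨k1, k2, k3, k4⟩ := key p u h1
      have e1 := pivotAdj_comm G u p
      have e2 := simFun_comm sim u p
      have e3 : O u p ↔ O p u := ⟨hO.symm, hO.symm⟩
      simp only [e1, e2, e3, h1, Ne.symm h1, hself, if_false, if_true, true_or, or_true,
        true_and, and_true]
      by_cases a1 : PivotAdj G p u <;> by_cases o1 : O p u <;> simp only [a1, o1, if_true, if_false,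
        not_true, not_false_iff, forall_const, IsEmpty.forall_iff, or_self] at k3 k4 ⊢ <;> linarith
    · by_cases h3 : v = p
      · subst h3
        obtain ⟨k1, k2, k3, k4⟩ := key u v h2
        have e1 := pivotAdj_comm G v u
        have e2 := simFun_comm sim v u
        have e3 : O v u ↔ O u v := ⟨hO.symm, hO.symm⟩
        simp only [e1, e2, e3, h2, Ne.symm h2, hself, if_false, if_true, true_or, or_true,
          true_and, and_true]
        by_cases a1 : PivotAdj G u v <;> by_cases o1 : O u v <;> simp only [a1, o1, if_true,
          if_false, not_true, not_false_iff, forall_const, IsEmpty.forall_iff, or_self]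
          at k3 k4 ⊢ <;> linarith
      · obtain ⟨k1, k2, k3, k4⟩ := key p u h1
        obtain ⟨l1, l2, l3, l4⟩ := key u v h2
        obtain ⟨m1, m2, m3, m4⟩ := key v p h3
        have e1 := pivotAdj_comm G u p
        have e2 := pivotAdj_comm G v u
        have e3 := pivotAdj_comm G p v
        have t1 : O p u → O u v → O v p := fun x y => hO.symm (hO.trans x y)
        have t2 : O u v → O v p → O p u := fun x y => hO.symm (hO.trans x y)
        have t3 : O v p → O p u → O u v := fun x y => hO.symm (hO.trans x y)
        simp only [e1, e2, e3, h1, h2, h3, if_false]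
        -- Eight adjacency patterns; in each, `t1`, `t2`, `t3` rule out the clusterings that violate
        -- transitivity, and the rest is linear.
        by_cases a1 : PivotAdj G p u <;> by_cases a2 : PivotAdj G u v <;>
          by_cases a3 : PivotAdj G v p <;>
          simp only [a1, a2, a3, if_true, if_false, or_true, or_false, or_self, and_true, and_false,
            not_true, not_false_iff, forall_const, IsEmpty.forall_iff] at k3 k4 l3 l4 m3 m4 ⊢ <;>
          (try linarith) <;>
          by_cases o1 : O p u <;> by_cases o2 : O u v <;> by_cases o3 : O v p <;>
          simp only [o1, o2, o3, forall_const, IsEmpty.forall_iff] at t1 t2 t3 <;>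
          simp only [o1, o2, o3, if_true, if_false] <;> linarith

theorem expectedCost_kwikCluster_le {V : Type*} [Fintype V] [DecidableEq V] (sim : Pair V → ℝ)
    (hsim : ∀ e, sim e ∈ Set.Icc (0 : ℝ) 1) (η : ℝ) (hη : 0 ≤ η) (G : Finset (Pair V))
    (hG : ∀ e ∈ G, 1 / 2 - η ≤ sim e) (hB : ∀ e ∉ G, sim e ≤ 1 / 2 + η) :
    expectedCost sim (kwikCluster G Finset.univ) ≤ 5 * OPT sim + 8 * numPairs V * η := by
  classical
  obtain ⟨Q, hQ⟩ : ∃ Q : Clustering V, cost sim Q = OPT sim := exists_eq_ciInf_of_finite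
  set O : V → V → Prop := fun u v => ∃ C ∈ Q.parts, u ∈ C ∧ v ∈ C with hOdef
  have hO : Equivalence O := by
    refine ⟨fun u => ?_, fun ⟨C, hC, h, h'⟩ => ⟨C, hC, h', h⟩, ?_⟩
    · obtain ⟨C, hC, h⟩ := Q.exists_mem (Finset.mem_univ u)
      exact ⟨C, hC, h, h⟩
    · rintro x y z ⟨C, hC, hx, hy⟩ ⟨D, hD, hy', hz⟩
      obtain rfl := Q.eq_of_mem_parts hC hD hy hy'
      exact ⟨C, hC, hx, hz⟩
  have h1 := sum_kwikCluster_le sim G (charge sim η O) (fun R => by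
    have := sum_triple_nonpos R _ (triangle_charge sim hsim η hη G hG hB O hO _ rfl)
    rw [← sub_nonpos, ← Finset.sum_sub_distrib]
    refine le_of_eq_of_le (Finset.sum_congr rfl fun p _ => ?_) this
    rw [sum_sum_sdiff, pivotCost, ← Finset.sum_add_distrib, ← Finset.sum_sub_distrib]
    refine Finset.sum_congr rfl fun u hu => ?_
    rw [← Finset.sum_add_distrib, ← Finset.sum_sub_distrib]
    refine Finset.sum_congr rfl fun v hv => ?_
    simp only [mem_pivotCluster G hu, mem_pivotCluster G hv]
    split_ifs <;> ring) Finset.univ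
  have h2 : ∑ P, (kwikCluster G Finset.univ P).toReal * costOn sim Finset.univ P
      = 2 * expectedCost sim (kwikCluster G Finset.univ) := by
    rw [expectedCost, Finset.mul_sum]
    refine Finset.sum_congr rfl fun P _ => ?_
    rw [costOn, sum_orderedCost]
    ring
  have h3 : ∑ u, ∑ v, charge sim η O u v = 2 * ∑ e : Pair V,
      (5 * (if SameCluster Q e then 1 - sim e else sim e) + 8 * η) := by
    refine sum_pair _ _ (fun u => by simp [charge]) fun u v h => ?_
    have huv : u ≠ v := by simpa using h
    simp only [charge, orderedCost, huv, if_false, SameCluster, Sym2.ball, simFun, dite_false,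
      hOdef]
    split_ifs <;> rfl
  rw [h2, h3, Finset.sum_add_distrib, ← Finset.mul_sum, Finset.sum_const, Finset.card_univ,
    nsmul_eq_mul] at h1
  change _ ≤ 2 * (5 * cost sim Q + (numPairs V : ℝ) * (8 * η)) at h1
  rw [hQ] at h1
  linarith

/-! ### Deterministic analysis of TB-HS -/

section Run

/-- The empirical mean of the first `k` answers. -/
noncomputable def empMean (y : ℕ → ℝ) (k : ℕ) : ℝ := (∑ i ∈ Finset.range k, y i) / k

/-- After `k` queries with answers `y`, TB-HS leaves the pair undecided. -/
def Unresolved (m : ℕ) (η δ : ℝ) (y : ℕ → ℝ) (k : ℕ) : Prop :=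
  empMean y k - radius m δ k < 1 / 2 - η ∧ 1 / 2 + η < empMean y k + radius m δ k

/-- The invariants of TB-HS. -/
structure RunInvariant {V : Type*} [Fintype V] [DecidableEq V] (η δ : ℝ) (x : Pair V → ℕ → ℝ)
    (S : State V) : Prop where
  total_eq : ∀ e, S.total e = ∑ i ∈ Finset.range (S.count e), x e i
  unresolved : ∀ e k, 1 ≤ k → k < S.count e → Unresolved (numPairs V) η δ (x e) k
  unresolved_count : ∀ e, e ∉ S.good → e ∉ S.bad → 1 ≤ S.count e →
    Unresolved (numPairs V) η δ (x e) (S.count e)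
  good : ∀ e ∈ S.good, 1 ≤ S.count e ∧
    1 / 2 - η ≤ empMean (x e) (S.count e) - radius (numPairs V) δ (S.count e)
  bad : ∀ e ∈ S.bad, 1 ≤ S.count e ∧
    empMean (x e) (S.count e) + radius (numPairs V) δ (S.count e) ≤ 1 / 2 + η

variable {V : Type*} [Fintype V] [DecidableEq V]

theorem runInvariant_init (η δ : ℝ) (x : Pair V → ℕ → ℝ) :
    RunInvariant η δ x (State.init V) := by
  constructor <;> simp [State.init]

theorem classify_count (η δ : ℝ) (S : State V) (e : Pair V) :
    (S.classify η δ e).count = S.count := by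
  unfold State.classify
  split_ifs <;> rfl

/-- The selected pair is in neither list, so decided pairs keep their count, and with it the
inequality that decided them. -/
theorem runInvariant_step {η δ : ℝ} {rule : SamplingRule V} {x : Pair V → ℕ → ℝ} {S : State V}
    (h : RunInvariant η δ x S) : RunInvariant η δ x (tbhsStep η δ rule x S) := by
  unfold tbhsStep
  split_ifs with hne
  swap
  · exact h
  have he := rule.select_mem S.history _ hne
  set e := rule.select S.history S.undecided
  change RunInvariant η δ x ((S.record e (x e (S.count e))).classify η δ e)
  simp only [State.undecided, Finset.mem_sdiff, Finset.mem_univ, Finset.mem_union, not_or,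
    true_and] at he
  obtain ⟨heg, heb⟩ := he
  have hmean : (S.record e (x e (S.count e))).mean e = empMean (x e) (S.count e + 1) := by
    simp [State.mean, State.record, empMean, h.total_eq, Finset.sum_range_succ]
  have htot : ∀ f, (S.record e (x e (S.count e))).total f
      = ∑ i ∈ Finset.range ((S.record e (x e (S.count e))).count f), x f i := by
    intro f
    by_cases hf : f = e
    · subst hf
      simp [State.record, h.total_eq, Finset.sum_range_succ]
    · simp [State.record, hf, h.total_eq]
  have hcount : (S.record e (x e (S.count e))).count e = S.count e + 1 := by simp [State.record]
  have hcount' : ∀ f, f ≠ e → (S.record e (x e (S.count e))).count f = S.count f := by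
    intro f hf
    simp [State.record, hf]
  have hunr : ∀ f k, 1 ≤ k → k < (S.record e (x e (S.count e))).count f →
      Unresolved (numPairs V) η δ (x f) k := by
    intro f k hk hkf
    by_cases hf : f = e
    · subst hf
      rw [hcount] at hkf
      -- The only new index is the old count, at which the pair was still undecided.
      rcases Nat.lt_succ_iff_lt_or_eq.1 hkf with hlt | rfl
      · exact h.unresolved _ k hk hlt
      · exact h.unresolved_count _ heg heb hk
    · rw [hcount' f hf] at hkf
      exact h.unresolved f k hk hkf
  have hgood : ∀ f ∈ S.good, 1 ≤ (S.record e (x e (S.count e))).count f ∧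
      1 / 2 - η ≤ empMean (x f) ((S.record e (x e (S.count e))).count f)
        - radius (numPairs V) δ ((S.record e (x e (S.count e))).count f) := by
    intro f hf
    rw [hcount' f (fun hfe => heg (hfe ▸ hf))]
    exact h.good f hf
  have hbad : ∀ f ∈ S.bad, 1 ≤ (S.record e (x e (S.count e))).count f ∧
      empMean (x f) ((S.record e (x e (S.count e))).count f)
        + radius (numPairs V) δ ((S.record e (x e (S.count e))).count f) ≤ 1 / 2 + η := by
    intro f hf
    rw [hcount' f (fun hfe => heb (hfe ▸ hf))]
    exact h.bad f hf
  have hother : ∀ f, f ≠ e → f ∉ S.good → f ∉ S.bad →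
      1 ≤ (S.record e (x e (S.count e))).count f →
      Unresolved (numPairs V) η δ (x f) ((S.record e (x e (S.count e))).count f) := by
    intro f hf
    rw [hcount' f hf]
    exact h.unresolved_count f
  have hg0 : (S.record e (x e (S.count e))).good = S.good := rfl
  have hb0 : (S.record e (x e (S.count e))).bad = S.bad := rfl
  rw [← hg0] at hgood hother
  rw [← hb0] at hbad hother
  rw [← hcount] at hmean
  generalize S.record e (x e (S.count e)) = S' at *
  unfold State.classify
  rw [hmean]
  split_ifs with c1 c2
  · refine ⟨htot, hunr, ?_, ?_, hbad⟩
    · intro f hf1 hf2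
      have hf : f ∉ insert e S'.good := hf1
      rw [Finset.mem_insert, not_or] at hf
      exact hother f hf.1 hf.2 hf2
    · intro f hf
      rcases Finset.mem_insert.1 hf with rfl | hf
      · exact ⟨by simp [hcount], c1⟩
      · exact hgood f hf
  · refine ⟨htot, hunr, ?_, hgood, ?_⟩
    · intro f hf1 hf2
      have hf : f ∉ insert e S'.bad := hf2
      rw [Finset.mem_insert, not_or] at hf
      exact hother f hf.1 hf1 hf.2
    · intro f hf
      rcases Finset.mem_insert.1 hf with rfl | hf
      · exact ⟨by simp [hcount], c2⟩
      · exact hbad f hf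
  · refine ⟨htot, hunr, ?_, hgood, hbad⟩
    intro f hf1 hf2 hf3
    by_cases hf : f = e
    · subst hf
      exact ⟨not_le.1 c1, not_le.1 c2⟩
    · exact hother f hf hf1 hf2 hf3

theorem runInvariant_run (η δ : ℝ) (rule : SamplingRule V) (x : Pair V → ℕ → ℝ) (t : ℕ) :
    RunInvariant η δ x (tbhsRun η δ rule x t) := by
  induction t with
  | zero => exact runInvariant_init η δ x
  | succ t ih => exact runInvariant_step ih

/-- Until TB-HS stops, each round makes one query. -/
theorem sum_count_run (η δ : ℝ) (rule : SamplingRule V) (x : Pair V → ℕ → ℝ) (t : ℕ)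
    (ht : ∀ t' < t, (tbhsRun η δ rule x t').undecided.Nonempty) :
    ∑ e, (tbhsRun η δ rule x t).count e = t := by
  induction t with
  | zero => simp [tbhsRun, State.init]
  | succ t ih =>
    have ih := ih fun t' h => ht t' (h.trans t.lt_succ_self)
    rw [tbhsRun, tbhsStep, if_pos (ht t t.lt_succ_self)]
    simp only [classify_count, State.record]
    refine Eq.trans ?_ (congrArg (· + 1) ih)
    generalize tbhsRun η δ rule x t = S
    rw [Finset.sum_update_of_mem (Finset.mem_univ _),
      ← Finset.add_sum_erase Finset.univ _ (Finset.mem_univ (rule.select S.history S.undecided)),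
      Finset.sdiff_singleton_eq_erase]
    ring

open Classical in
/-- The number of queries is bounded by the numbers of rounds at which the pairs are unresolved. -/
theorem tbhsQueries_le (η δ : ℝ) (rule : SamplingRule V) (x : Pair V → ℕ → ℝ) :
    (tbhsQueries η δ rule x : ℝ≥0∞) ≤ ∑ e : Pair V, (1 + ∑' k : ℕ,
      if Unresolved (numPairs V) η δ (x e) (k + 1) then (1 : ℝ≥0∞) else 0) := by
  have main : ∀ t : ℕ, (t : ℕ∞) ≤ tbhsQueries η δ rule x → (t : ℝ≥0∞) ≤ ∑ e : Pair V,
      (1 + ∑' k : ℕ, if Unresolved (numPairs V) η δ (x e) (k + 1) then (1 : ℝ≥0∞) else 0) := by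
    intro t ht
    have h1 := sum_count_run η δ rule x t fun t' ht' => by
      by_contra hne
      have : tbhsQueries η δ rule x ≤ (t' : ℕ∞) :=
        iInf₂_le t' (Finset.not_nonempty_iff_eq_empty.1 hne)
      exact absurd (ht.trans this) (by exact_mod_cast not_le.2 ht')
    have hinv := runInvariant_run η δ rule x t
    rw [← h1, Nat.cast_sum]
    refine Finset.sum_le_sum fun e _ => ?_
    -- The extra 1 is the last query, which may decide the pair; all earlier ones left it
    -- unresolved. Truncated subtraction also covers count 0.
    have h2 : ((tbhsRun η δ rule x t).count e : ℝ≥0∞)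
        ≤ 1 + ((tbhsRun η δ rule x t).count e - 1 : ℕ) := by
      exact_mod_cast (by omega :
        (tbhsRun η δ rule x t).count e ≤ 1 + ((tbhsRun η δ rule x t).count e - 1))
    refine h2.trans (add_le_add le_rfl ?_)
    refine le_trans (le_of_eq ?_)
      (ENNReal.sum_le_tsum (Finset.range ((tbhsRun η δ rule x t).count e - 1)))
    rw [Finset.sum_congr rfl (g := fun _ => (1 : ℝ≥0∞)), Finset.sum_const, Finset.card_range,
      nsmul_eq_mul, mul_one]
    intro k hk
    rw [Finset.mem_range] at hk
    exact if_pos (hinv.unresolved e (k + 1) (by omega) (by omega))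
  -- If the run never stops, `main` applies to every natural number and forces the right side to be
  -- infinite.
  rcases hT : tbhsQueries η δ rule x with _ | T
  · refine le_of_forall_lt fun c hc => ?_
    obtain ⟨n, hn⟩ := ENNReal.exists_nat_gt hc.ne_top
    exact hn.trans_le (main n (by rw [hT]; exact le_top))
  · exact main T hT.ge

theorem undecided_tbhsQueries (η δ : ℝ) (rule : SamplingRule V) (x : Pair V → ℕ → ℝ)
    (h : tbhsQueries η δ rule x ≠ ⊤) :
    (tbhsRun η δ rule x (tbhsQueries η δ rule x).toNat).undecided = ∅ := by
  by_contra hne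
  obtain ⟨T, hT⟩ := ENat.ne_top_iff_exists.1 h
  rw [← hT, ENat.toNat_natCast] at hne
  have : ((T + 1 : ℕ) : ℕ∞) ≤ tbhsQueries η δ rule x := by
    refine le_iInf₂ fun t ht => ?_
    rw [Nat.cast_le, Nat.succ_le_iff]
    by_contra hlt
    have h1 : (T : ℕ∞) ≤ (t : ℕ∞) := by rw [hT]; exact iInf₂_le t ht
    obtain rfl : t = T := le_antisymm (not_lt.1 hlt) (by exact_mod_cast h1)
    exact hne ht
  rw [← hT] at this
  exact absurd this (by exact_mod_cast (by omega : ¬ T + 1 ≤ T))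

/-- If TB-HS stops and all confidence intervals are valid, its answer is correct up to `η`. -/
theorem tbhsGood_correct (η δ : ℝ) (rule : SamplingRule V) (x : Pair V → ℕ → ℝ) (sim : Pair V → ℝ)
    (h : tbhsQueries η δ rule x ≠ ⊤)
    (hx : ∀ e k, 1 ≤ k → |empMean (x e) k - sim e| < radius (numPairs V) δ k) :
    (∀ e ∈ tbhsGood η δ rule x, 1 / 2 - η ≤ sim e) ∧
      ∀ e ∉ tbhsGood η δ rule x, sim e ≤ 1 / 2 + η := by
  have hinv := runInvariant_run η δ rule x (tbhsQueries η δ rule x).toNat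
  have hund := undecided_tbhsQueries η δ rule x h
  constructor
  · intro e he
    obtain ⟨h1, h2⟩ := hinv.good e he
    have := (abs_lt.1 (hx e _ h1)).2
    linarith
  · intro e he
    have hmem : e ∉ (tbhsRun η δ rule x (tbhsQueries η δ rule x).toNat).undecided := by simp [hund]
    simp only [State.undecided, Finset.mem_sdiff, Finset.mem_univ, true_and, not_not,
      Finset.mem_union] at hmem
    obtain ⟨h1, h2⟩ := hinv.bad e (hmem.resolve_left he)
    have := (abs_lt.1 (hx e _ h1)).1
    linarith

/-- For s ≥ 1/2 the failed test for `good` puts the mean below 1/2 - η + rad, hence more than (s -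
1/2) + η - rad ≥ rad below s. For s < 1/2 the failed test for `bad` is used symmetrically. -/
theorem radius_le_abs_of_unresolved {m : ℕ} {η δ : ℝ} {y : ℕ → ℝ} {k : ℕ} {s : ℝ}
    (hk : 2 * radius m δ k ≤ |s - 1 / 2| + η) (h : Unresolved m η δ y k) :
    radius m δ k ≤ |empMean y k - s| := by
  obtain ⟨h1, h2⟩ := h
  rcases abs_cases (s - 1 / 2) with ⟨h3, _⟩ | ⟨h3, _⟩
  · rw [abs_sub_comm]
    exact le_trans (by linarith) (le_abs_self _)
  · exact le_trans (by linarith) (le_abs_self _)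

end Run

/-! ### Concentration -/

/-- The sum equals c·π²/12, and π² < 12. -/
theorem tsum_ofReal_deviation_le {c : ℝ} (hc : 0 ≤ c) :
    ∑' k : ℕ, ENNReal.ofReal (c / (2 * ((k + 1 : ℕ) : ℝ) ^ 2)) ≤ ENNReal.ofReal c := by
  have h1 : HasSum (fun k : ℕ => 1 / ((k + 1 : ℕ) : ℝ) ^ 2) (Real.pi ^ 2 / 6) := by
    simpa using (hasSum_nat_add_iff' 1).2 hasSum_zeta_two
  have h2 : HasSum (fun k : ℕ => c / (2 * ((k + 1 : ℕ) : ℝ) ^ 2)) (c / 2 * (Real.pi ^ 2 / 6)) := by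
    have h : ∀ k : ℕ, c / (2 * ((k + 1 : ℕ) : ℝ) ^ 2) = c / 2 * (1 / ((k + 1 : ℕ) : ℝ) ^ 2) :=
      fun k => by ring
    simpa only [h] using h1.mul_left (c / 2)
  rw [← ENNReal.ofReal_tsum_of_nonneg (fun k => by positivity) h2.summable, h2.tsum_eq]
  refine ENNReal.ofReal_le_ofReal ?_
  nlinarith [Real.pi_lt_d2, Real.pi_pos, mul_nonneg hc (by nlinarith [Real.pi_lt_d2, Real.pi_pos] :
    (0 : ℝ) ≤ 12 - Real.pi ^ 2)]

theorem two_mul_radius_sq {m k : ℕ} {δ : ℝ} (hm : 1 ≤ m) (hk : 1 ≤ k) (hδ : 0 < δ) (hδ1 : δ < 1) :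
    2 * k * radius m δ k ^ 2 = Real.log (4 * m * (k : ℝ) ^ 2 / δ) := by
  have hk' : (1 : ℝ) ≤ k := by exact_mod_cast hk
  have hm' : (1 : ℝ) ≤ m := by exact_mod_cast hm
  have h1 : 1 ≤ 4 * m * (k : ℝ) ^ 2 / δ := by
    rw [le_div_iff₀ hδ]
    nlinarith [mul_le_mul hm' (one_le_pow₀ hk' (n := 2)) zero_le_one (by positivity)]
  rw [radius, Real.sq_sqrt (div_nonneg (Real.log_nonneg h1) (by positivity))]
  field_simp

/-- Hoeffding with variance proxy 1/4: each tail is at most exp(-2k·rad²) = δ/(4mk²), and there are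
two tails. -/
theorem measure_empMean_sub_ge_le {Ω : Type*} [MeasurableSpace Ω] {μ : Measure Ω}
    [IsProbabilityMeasure μ] {Y : ℕ → Ω → ℝ} {s : ℝ} (hY : ∀ k, Measurable (Y k))
    (hI : ∀ k, ∀ᵐ ω ∂μ, Y k ω ∈ Set.Icc (0 : ℝ) 1) (hs : ∀ k, ∫ ω, Y k ω ∂μ = s)
    (hind : iIndepFun Y μ) {m k : ℕ} {δ : ℝ} (hm : 1 ≤ m) (hk : 1 ≤ k) (hδ : 0 < δ) (hδ1 : δ < 1) :
    μ.real {ω | radius m δ k ≤ |empMean (fun i => Y i ω) k - s|} ≤ δ / m / (2 * (k : ℝ) ^ 2) := by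
  have hk' : (0 : ℝ) < k := by exact_mod_cast hk
  have hm' : (0 : ℝ) < m := by exact_mod_cast hm
  have hr : 0 ≤ radius m δ k := Real.sqrt_nonneg _
  have hsub : ∀ i, HasSubgaussianMGF (fun ω => Y i ω - s) ((‖(1 : ℝ) - 0‖₊ / 2) ^ 2) μ := fun i => by
    simpa [hs i] using hasSubgaussianMGF_of_mem_Icc (hY i).aemeasurable (hI i)
  have hind1 : iIndepFun (fun i ω => Y i ω - s) μ :=
    hind.comp (fun _ y => y - s) fun _ => by fun_prop
  have hind2 : iIndepFun (fun i ω => -(Y i ω - s)) μ :=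
    hind.comp (fun _ y => -(y - s)) fun _ => by fun_prop
  have h1 := HasSubgaussianMGF.measure_sum_range_ge_le_of_iIndepFun hind1
    (n := k) (fun i _ => hsub i) (mul_nonneg hk'.le hr)
  have h2 := HasSubgaussianMGF.measure_sum_range_ge_le_of_iIndepFun hind2
    (n := k) (fun i _ => (hsub i).neg) (mul_nonneg hk'.le hr)
  have hexp : Real.exp (-(k * radius m δ k) ^ 2 / (2 * k * (((‖(1 : ℝ) - 0‖₊ / 2) ^ 2 : NNReal) : ℝ)))
      = δ / (4 * m * (k : ℝ) ^ 2) := by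
    have e1 : -(k * radius m δ k) ^ 2 / (2 * k * (((‖(1 : ℝ) - 0‖₊ / 2) ^ 2 : NNReal) : ℝ))
        = -(2 * k * radius m δ k ^ 2) := by
      push_cast
      simp only [sub_zero, norm_one]
      field_simp
    rw [e1, two_mul_radius_sq hm hk hδ hδ1, Real.exp_neg, Real.exp_log (by positivity), inv_div]
  rw [hexp] at h1 h2
  refine (measureReal_mono (fun ω hω => ?_) (measure_ne_top _ _)).trans
    ((measureReal_union_le _ _).trans ((add_le_add h1 h2).trans (le_of_eq ?_)))
  · have hω' : radius m δ k ≤ |empMean (fun i => Y i ω) k - s| := hω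
    have hsum : ∑ i ∈ Finset.range k, (Y i ω - s) = k * (empMean (fun i => Y i ω) k - s) := by
      rw [Finset.sum_sub_distrib, empMean, Finset.sum_const, Finset.card_range, nsmul_eq_mul]
      field_simp
    rcases le_abs.1 hω' with h | h
    · left
      change _ ≤ ∑ i ∈ Finset.range k, (Y i ω - s)
      rw [hsum]
      exact mul_le_mul_of_nonneg_left h hk'.le
    · right
      change _ ≤ ∑ i ∈ Finset.range k, -(Y i ω - s)
      rw [Finset.sum_neg_distrib, hsum, ← mul_neg]
      exact mul_le_mul_of_nonneg_left h hk'.le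
  · field_simp
    norm_num

/-! ### Sample sizes -/

/-- With X = √(m/δ)/g² and y = kg², the logarithm in the radius is 2·log(2Xy). Writing 2y =
32·(y/16) and using log z ≤ z - 1 bounds it by 2(log X + 3 + y/16). The claim then needs 3y/4 ≥
4·log X + 12, which y ≥ 6·log X + 16 ensures. -/
theorem two_mul_radius_le {m k : ℕ} {δ g : ℝ} (hm : 1 ≤ m) (hk : 1 ≤ k) (hδ : 0 < δ) (hδ1 : δ < 1)
    (hg : 0 < g) (hX : 1 ≤ Real.sqrt (m / δ) / g ^ 2)
    (h : (6 * Real.log (Real.sqrt (m / δ) / g ^ 2) + 16) / g ^ 2 ≤ k) :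
    2 * radius m δ k ≤ g := by
  have hk' : (0 : ℝ) < k := by exact_mod_cast hk
  have hm' : (0 : ℝ) < m := by exact_mod_cast hm
  have hlogX := Real.log_nonneg hX
  set X := Real.sqrt (m / δ) / g ^ 2 with hXdef
  have hX0 : 0 < X := by linarith
  set y := k * g ^ 2 with hy
  have hy0 : 0 < y := by positivity
  rw [div_le_iff₀ (by positivity)] at h
  have h1 : 4 * m * (k : ℝ) ^ 2 / δ = (X * (32 * (y / 16))) ^ 2 := by
    have h2 : Real.sqrt (m / δ) ^ 2 = m / δ := Real.sq_sqrt (by positivity)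
    have h3 : X * (32 * (y / 16)) = 2 * k * Real.sqrt (m / δ) := by
      rw [hXdef, hy]
      field_simp
      norm_num
    rw [h3, mul_pow, h2]
    ring
  have h4 : Real.log (X * (32 * (y / 16))) ≤ Real.log X + (3 + y / 16) := by
    rw [Real.log_mul hX0.ne' (by positivity), Real.log_mul (by norm_num) (by positivity)]
    have h5 : Real.log (y / 16) ≤ y / 16 - 1 := Real.log_le_sub_one_of_pos (by positivity)
    have h6 : Real.log 32 ≤ 4 := by
      rw [show (32 : ℝ) = 2 ^ 5 by norm_num, Real.log_pow]
      have := Real.log_two_lt_d9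
      push_cast
      linarith
    linarith
  have h7 := two_mul_radius_sq hm hk hδ hδ1
  rw [h1, Real.log_pow] at h7
  push_cast at h7
  have h8 : (k * (2 * radius m δ k) ^ 2 : ℝ) ≤ k * g ^ 2 := by nlinarith
  exact le_of_sq_le_sq (le_of_mul_le_mul_left h8 hk') hg.le

/-- The difficulty is that log log X may be negative. If log X ≥ 1 it is not, and 25·log X dominates
6·log X + 16. Otherwise 1/g² ≤ X ≤ 3, so everything is bounded; X ≥ 16/9 keeps log(X·log X) above
-2/7, and the summand 4 compensates. -/
theorem sampleSize_le {a g : ℝ} (ha : 1 ≤ a) (hg : 0 < g) (hg1 : g ≤ 3 / 4) :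
    3 + (6 * Real.log (a / g ^ 2) + 16) / g ^ 2
      ≤ 25 * (1 / g ^ 2 * Real.log (a / g ^ 2 * Real.log (a / g ^ 2)) + 4) := by
  have hg2 : g ^ 2 ≤ 9 / 16 := by nlinarith
  have hg0 : 0 < g ^ 2 := by positivity
  set X := a / g ^ 2 with hX
  have hX1 : 16 / 9 ≤ X := by
    rw [hX, le_div_iff₀ hg0]
    linarith
  have hX2 : 1 / g ^ 2 ≤ X := div_le_div_of_nonneg_right ha hg0.le
  have hi : 0 < 1 / g ^ 2 := by positivity
  have hX0 : 0 < X := by linarith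
  have hlog : 7 / 16 ≤ Real.log X := by
    have h1 := Real.one_sub_inv_le_log_of_pos hX0
    have h2 : X⁻¹ ≤ (16 / 9)⁻¹ := inv_anti₀ (by norm_num) hX1
    norm_num at h2
    linarith
  rw [Real.log_mul hX0.ne' (by linarith), div_eq_mul_one_div]
  rcases le_total 1 (Real.log X) with h | h
  · have h3 : 0 ≤ Real.log (Real.log X) := Real.log_nonneg h
    nlinarith [mul_nonneg hi.le h3, mul_nonneg hi.le (sub_nonneg.2 h)]
  · have hXe : X ≤ 3 := by
      have := (Real.log_le_iff_le_exp hX0).1 h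
      linarith [Real.exp_one_lt_d9]
    have h3 : -(2 / 7) ≤ Real.log X + Real.log (Real.log X) := by
      rw [← Real.log_mul hX0.ne' (by linarith)]
      have h4 : 7 / 9 ≤ X * Real.log X := by nlinarith
      have h5 := Real.one_sub_inv_le_log_of_pos (show 0 < X * Real.log X by linarith)
      have h6 : (X * Real.log X)⁻¹ ≤ (7 / 9)⁻¹ := inv_anti₀ (by norm_num) h4
      have h7 : ((7 : ℝ) / 9)⁻¹ = 9 / 7 := by norm_num
      linarith
    nlinarith [mul_nonneg hi.le (sub_nonneg.2 h), mul_nonneg hi.le (sub_nonneg.2 h3)]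

section Gaps

variable {V : Type*} {sim : Pair V → ℝ}

theorem gap_le_half (hsim : ∀ e, sim e ∈ Set.Icc (0 : ℝ) 1) (e : Pair V) : gap sim e ≤ 1 / 2 :=
  abs_le.2 ⟨by linarith [(hsim e).1], by linarith [(hsim e).2]⟩

theorem gapMin_le [Fintype V] (sim : Pair V → ℝ) (e : Pair V) : gapMin sim ≤ gap sim e :=
  ciInf_le (Set.finite_range _).bddBelow e

theorem gapTilde_pos [Fintype V] {η : ℝ} (hη : 0 < η) (e : Pair V) : 0 < gapTilde sim η e := by
  have h1 := gapMin_le sim e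
  have h2 : 0 ≤ gap sim e := abs_nonneg _
  unfold gapTilde
  rcases min_choice (η - gapMin sim) (η / 2) with h | h <;> rw [h] <;> linarith

theorem gapTilde_le (sim : Pair V → ℝ) (η : ℝ) (e : Pair V) :
    gapTilde sim η e ≤ gap sim e + η / 2 :=
  add_le_add le_rfl (min_le_right _ _)

theorem one_le_sqrt_div {m : ℕ} {δ : ℝ} (hm : 1 ≤ m) (hδ : 0 < δ) (hδ1 : δ < 1) :
    1 ≤ Real.sqrt (m / δ) := by
  rw [Real.one_le_sqrt, le_div_iff₀ hδ]
  have : (1 : ℝ) ≤ m := by exact_mod_cast hm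
  linarith

variable [Fintype V] [DecidableEq V]

/-- A number of queries after which a pair is decided unless its empirical mean deviates. -/
noncomputable def sampleSize (sim : Pair V → ℝ) (η δ : ℝ) (e : Pair V) : ℕ :=
  ⌈(6 * Real.log (Real.sqrt (numPairs V / δ) / gapTilde sim η e ^ 2) + 16)
    / gapTilde sim η e ^ 2⌉₊

theorem one_le_sqrt_div_gapTilde (hsim : ∀ e, sim e ∈ Set.Icc (0 : ℝ) 1) {η δ : ℝ} (hη : 0 < η)
    (hη1 : η < 1 / 2) (hδ : 0 < δ) (hδ1 : δ < 1) (hm : 1 ≤ numPairs V) (e : Pair V) :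
    1 ≤ Real.sqrt (numPairs V / δ) / gapTilde sim η e ^ 2 := by
  have h1 := gapTilde_pos (sim := sim) hη e
  have h2 := gapTilde_le sim η e
  have h3 := gap_le_half hsim e
  have h4 := one_le_sqrt_div hm hδ hδ1
  rw [le_div_iff₀ (by positivity)]
  nlinarith

theorem two_mul_radius_le_of_sampleSize_le (hsim : ∀ e, sim e ∈ Set.Icc (0 : ℝ) 1) {η δ : ℝ}
    (hη : 0 < η) (hη1 : η < 1 / 2) (hδ : 0 < δ) (hδ1 : δ < 1) (hm : 1 ≤ numPairs V) (e : Pair V)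
    {k : ℕ} (hk : 1 ≤ k) (h : sampleSize sim η δ e ≤ k) :
    2 * radius (numPairs V) δ k ≤ |sim e - 1 / 2| + η := by
  refine (two_mul_radius_le hm hk hδ hδ1 (gapTilde_pos hη e)
    (one_le_sqrt_div_gapTilde hsim hη hη1 hδ hδ1 hm e) (Nat.ceil_le.1 h)).trans ?_
  have := gapTilde_le sim η e
  unfold gap at this
  linarith

/-- The 4 per pair comes from m/max{Δ_min, η/2}² ≥ 4m, since both gaps are at most 1/2. The 2 pays
for the deciding query and, in expectation, for the deviations; rounding up the sample size makes it
3. -/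
theorem sum_sampleSize_le (hsim : ∀ e, sim e ∈ Set.Icc (0 : ℝ) 1) {η δ : ℝ} (hη : 0 < η)
    (hη1 : η < 1 / 2) (hδ : 0 < δ) (hδ1 : δ < 1) (hm : 1 ≤ numPairs V) :
    ∑ e : Pair V, (2 + sampleSize sim η δ e : ℝ) ≤ 25 * sampleBound sim η δ := by
  have hne : Nonempty (Pair V) := Fintype.card_pos_iff.1 hm
  have hmax : max (gapMin sim) (η / 2) ≤ 1 / 2 :=
    max_le ((gapMin_le sim hne.some).trans (gap_le_half hsim _)) (by linarith)
  have hmax0 : 0 < max (gapMin sim) (η / 2) := lt_max_of_lt_right (by linarith)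
  have h4 : (numPairs V : ℝ) * 4 ≤ numPairs V / max (gapMin sim) (η / 2) ^ 2 := by
    rw [div_eq_mul_inv]
    refine mul_le_mul_of_nonneg_left ?_ (Nat.cast_nonneg _)
    rw [← one_div, le_div_iff₀ (by positivity)]
    nlinarith
  have h5 : (numPairs V : ℝ) * 4 = ∑ _e : Pair V, (4 : ℝ) := by
    rw [Finset.sum_const, Finset.card_univ, nsmul_eq_mul]
    rfl
  rw [h5] at h4
  refine le_trans ?_ (mul_le_mul_of_nonneg_left (add_le_add le_rfl h4) (by norm_num))
  rw [← Finset.sum_add_distrib, Finset.mul_sum]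
  refine Finset.sum_le_sum fun e _ => ?_
  have hg := gapTilde_pos (sim := sim) hη e
  have hg1 : gapTilde sim η e ≤ 3 / 4 := by
    linarith [gapTilde_le sim η e, gap_le_half hsim e]
  refine le_trans ?_ (sampleSize_le (one_le_sqrt_div hm hδ hδ1) hg hg1)
  have h6 := Nat.ceil_lt_add_one (div_nonneg (add_nonneg (mul_nonneg (by norm_num : (0 : ℝ) ≤ 6)
    (Real.log_nonneg (one_le_sqrt_div_gapTilde hsim hη hη1 hδ hδ1 hm e)))
    (by norm_num : (0 : ℝ) ≤ 16)) (sq_nonneg (gapTilde sim η e)))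
  unfold sampleSize
  linarith

open Classical in
/-- The number of queries is at most the sum of the sample sizes and the number of deviations. -/
theorem tbhsQueries_le_sampleSize (hsim : ∀ e, sim e ∈ Set.Icc (0 : ℝ) 1) {η δ : ℝ} (hη : 0 < η)
    (hη1 : η < 1 / 2) (hδ : 0 < δ) (hδ1 : δ < 1) (hm : 1 ≤ numPairs V) (rule : SamplingRule V)
    (x : Pair V → ℕ → ℝ) :
    (tbhsQueries η δ rule x : ℝ≥0∞) ≤ ∑ e : Pair V, (1 + sampleSize sim η δ e + ∑' k : ℕ,
      if radius (numPairs V) δ (k + 1) ≤ |empMean (x e) (k + 1) - sim e|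
        then (1 : ℝ≥0∞) else 0) := by
  refine (tbhsQueries_le η δ rule x).trans (Finset.sum_le_sum fun e _ => ?_)
  rw [add_assoc]
  refine add_le_add le_rfl ?_
  have h1 : (sampleSize sim η δ e : ℝ≥0∞)
      = ∑' k : ℕ, if k < sampleSize sim η δ e then (1 : ℝ≥0∞) else 0 := by
    rw [tsum_eq_sum (s := Finset.range (sampleSize sim η δ e))
      fun k hk => if_neg (by simpa using hk), Finset.sum_congr rfl (g := fun _ => (1 : ℝ≥0∞))
      fun k hk => if_pos (Finset.mem_range.1 hk)]
    simp
  rw [h1, ← ENNReal.tsum_add]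
  refine ENNReal.tsum_le_tsum fun k => ?_
  by_cases hu : Unresolved (numPairs V) η δ (x e) (k + 1)
  · rw [if_pos hu]
    -- An unresolved index is either below the sample size or a deviation.
    by_cases hk : k < sampleSize sim η δ e
    · rw [if_pos hk]
      exact le_self_add
    · rw [if_pos (c := radius (numPairs V) δ (k + 1) ≤ |empMean (x e) (k + 1) - sim e|)]
      · exact le_add_self
      · exact radius_le_abs_of_unresolved (two_mul_radius_le_of_sampleSize_le hsim hη hη1 hδ hδ1 hm
          e (by omega) (by omega)) hu
  · rw [if_neg hu]
    exact zero_le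

end Gaps

/-! ### The oracle -/

section Oracle

variable {V Ω : Type*} [Fintype V] [DecidableEq V] {sim : Pair V → ℝ} {X : Pair V → ℕ → Ω → ℝ}

/-- The event that the empirical mean of the first `k` answers for `e` leaves its confidence
interval. -/
def deviation (sim : Pair V → ℝ) (X : Pair V → ℕ → Ω → ℝ) (δ : ℝ) (e : Pair V) (k : ℕ) : Set Ω :=
  {ω | radius (numPairs V) δ k ≤ |empMean (fun i => X e i ω) k - sim e|}

theorem tbhsQueries_le_of_forall_not_mem_deviation (hsim : ∀ e, sim e ∈ Set.Icc (0 : ℝ) 1)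
    {η δ : ℝ} (hη : 0 < η) (hη1 : η < 1 / 2) (hδ : 0 < δ) (hδ1 : δ < 1) (hm : 1 ≤ numPairs V)
    (rule : SamplingRule V) {ω : Ω} (hω : ∀ e k, ω ∉ deviation sim X δ e (k + 1)) :
    (tbhsQueries η δ rule fun e k => X e k ω : ℝ≥0∞)
      ≤ ENNReal.ofReal (25 * sampleBound sim η δ) := by
  classical
  refine (tbhsQueries_le_sampleSize hsim hη hη1 hδ hδ1 hm rule _).trans ?_
  refine le_trans ?_ (ENNReal.ofReal_le_ofReal (sum_sampleSize_le hsim hη hη1 hδ hδ1 hm))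
  rw [ENNReal.ofReal_sum_of_nonneg fun e _ => by positivity]
  refine Finset.sum_le_sum fun e _ => ?_
  have h0 : ∀ k : ℕ, (if radius (numPairs V) δ (k + 1)
      ≤ |empMean (fun i => X e i ω) (k + 1) - sim e| then (1 : ℝ≥0∞) else 0) = 0 :=
    fun k => if_neg (hω e k)
  rw [tsum_congr h0, tsum_zero, add_zero,
    ENNReal.ofReal_add (by norm_num) (Nat.cast_nonneg _), ENNReal.ofReal_natCast,
    ENNReal.ofReal_ofNat]
  gcongr
  exact one_le_two

variable [MeasurableSpace Ω] {μ : Measure Ω}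

theorem measurableSet_deviation (hX : IsNoisyOracle μ sim X) (δ : ℝ) (e : Pair V) (k : ℕ) :
    MeasurableSet (deviation sim X δ e k) := by
  have := hX.measurable e
  unfold deviation empMean
  exact measurableSet_le measurable_const (by fun_prop)

variable [IsProbabilityMeasure μ]

theorem measure_deviation_le (hX : IsNoisyOracle μ sim X) {δ : ℝ} (hδ : 0 < δ) (hδ1 : δ < 1)
    (hm : 1 ≤ numPairs V) (e : Pair V) {k : ℕ} (hk : 1 ≤ k) :
    μ (deviation sim X δ e k) ≤ ENNReal.ofReal (δ / numPairs V / (2 * (k : ℝ) ^ 2)) := by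
  have hind : iIndepFun (X e) μ :=
    hX.indep.precomp (g := fun k : ℕ => (e, k)) (Prod.mk_right_injective e)
  rw [← ofReal_measureReal (measure_ne_top _ _)]
  exact ENNReal.ofReal_le_ofReal (measure_empMean_sub_ge_le (hX.measurable e) (hX.mem_Icc e)
    (hX.mean_eq e) hind hm hk hδ hδ1)

theorem tsum_measure_deviation_le (hX : IsNoisyOracle μ sim X) {δ : ℝ} (hδ : 0 < δ) (hδ1 : δ < 1)
    (hm : 1 ≤ numPairs V) (e : Pair V) :
    ∑' k : ℕ, μ (deviation sim X δ e (k + 1)) ≤ ENNReal.ofReal (δ / numPairs V) :=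
  (ENNReal.tsum_le_tsum fun k => measure_deviation_le hX hδ hδ1 hm e (by omega)).trans
    (tsum_ofReal_deviation_le (by positivity))

/-- The expected number of deviations of a pair is the sum of their probabilities, so no separate
tail analysis of T is needed. -/
theorem lintegral_tbhsQueries_le (hsim : ∀ e, sim e ∈ Set.Icc (0 : ℝ) 1)
    (hX : IsNoisyOracle μ sim X) {η δ : ℝ} (hη : 0 < η) (hη1 : η < 1 / 2) (hδ : 0 < δ)
    (hδ1 : δ < 1) (hm : 1 ≤ numPairs V) (rule : SamplingRule V) :
    ∫⁻ ω, (tbhsQueries η δ rule fun e k => X e k ω : ℝ≥0∞) ∂μ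
      ≤ ENNReal.ofReal (25 * sampleBound sim η δ) := by
  classical
  have hmeas : ∀ e k, Measurable fun ω => (deviation sim X δ e k).indicator
      (fun _ => (1 : ℝ≥0∞)) ω := fun e k =>
    measurable_const.indicator (measurableSet_deviation hX δ e k)
  calc _ ≤ ∫⁻ ω, ∑ e : Pair V, (1 + sampleSize sim η δ e + ∑' k : ℕ,
        (deviation sim X δ e (k + 1)).indicator (fun _ => (1 : ℝ≥0∞)) ω) ∂μ := by
        -- Only the dominating function has to be measurable; the selection rule, and hence T, is
        -- arbitrary.
        refine lintegral_mono fun ω => ?_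
        refine (tbhsQueries_le_sampleSize hsim hη hη1 hδ hδ1 hm rule _).trans (le_of_eq ?_)
        simp only [Set.indicator_apply, deviation, Set.mem_ofPred_eq]
    _ = ∑ e : Pair V, (1 + sampleSize sim η δ e
        + ∑' k : ℕ, μ (deviation sim X δ e (k + 1))) := by
        rw [lintegral_finsetSum]
        swap
        · exact fun e _ => Measurable.add measurable_const (.tsum fun k => hmeas e (k + 1))
        refine Finset.sum_congr rfl fun e _ => ?_
        rw [lintegral_add_left measurable_const, lintegral_tsum fun k => (hmeas e _).aemeasurable,
          lintegral_const, measure_univ, mul_one]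
        congr 1
        refine tsum_congr fun k => ?_
        rw [lintegral_indicator (measurableSet_deviation hX δ e _), lintegral_const, one_mul,
          Measure.restrict_apply_univ]
    _ ≤ ∑ e : Pair V, ENNReal.ofReal (2 + sampleSize sim η δ e) := by
        refine Finset.sum_le_sum fun e _ => ?_
        have h1 : ∑' k : ℕ, μ (deviation sim X δ e (k + 1)) ≤ 1 := by
          refine (tsum_measure_deviation_le hX hδ hδ1 hm e).trans ?_
          rw [← ENNReal.ofReal_one]
          refine ENNReal.ofReal_le_ofReal ?_
          have hm' : (1 : ℝ) ≤ numPairs V := by exact_mod_cast hm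
          rw [div_le_one (by linarith)]
          linarith
        refine (add_le_add le_rfl h1).trans (le_of_eq ?_)
        rw [ENNReal.ofReal_add (by norm_num) (Nat.cast_nonneg _), ENNReal.ofReal_natCast,
          ENNReal.ofReal_ofNat, ← one_add_one_eq_two]
        ring
    _ ≤ _ := by
        rw [← ENNReal.ofReal_sum_of_nonneg fun e _ => by positivity]
        exact ENNReal.ofReal_le_ofReal (sum_sampleSize_le hsim hη hη1 hδ hδ1 hm)

/-- With probability at least `1 - δ` no confidence interval is ever left. -/
theorem ofReal_one_sub_le_measure (hX : IsNoisyOracle μ sim X) {δ : ℝ} (hδ : 0 < δ)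
    (hδ1 : δ < 1) (hm : 1 ≤ numPairs V) :
    ENNReal.ofReal (1 - δ) ≤ μ {ω | ∀ e k, ω ∉ deviation sim X δ e (k + 1)} := by
  have hset : {ω | ∀ e k, ω ∉ deviation sim X δ e (k + 1)}
      = (⋃ e, ⋃ k, deviation sim X δ e (k + 1))ᶜ := by
    ext ω
    simp
  have hU : MeasurableSet (⋃ e, ⋃ k, deviation sim X δ e (k + 1)) :=
    MeasurableSet.iUnion fun e => MeasurableSet.iUnion fun k => measurableSet_deviation hX δ e _
  rw [hset, prob_compl_eq_one_sub hU, ENNReal.ofReal_sub _ hδ.le, ENNReal.ofReal_one]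
  refine tsub_le_tsub_left ?_ 1
  calc _ ≤ ∑ e, μ (⋃ k, deviation sim X δ e (k + 1)) := measure_iUnion_fintype_le _ _
    _ ≤ ∑ _e : Pair V, ENNReal.ofReal (δ / numPairs V) :=
        Finset.sum_le_sum fun e _ =>
          (measure_iUnion_le _).trans (tsum_measure_deviation_le hX hδ hδ1 hm e)
    _ = ENNReal.ofReal δ := by
        have hm' : (0 : ℝ) < numPairs V := by exact_mod_cast hm
        rw [Finset.sum_const, Finset.card_univ, nsmul_eq_mul,
          ← ENNReal.ofReal_natCast, ← ENNReal.ofReal_mul (Nat.cast_nonneg _)]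
        congr 1
        exact mul_div_cancel₀ δ hm'.ne'

end Oracle

end CorrClust

/-! ### Assembly of the cost and query bounds -/

theorem mainTheorem1 :
    ∃ K : ℝ, 0 < K ∧
      ∀ (V : Type u) [Fintype V] [DecidableEq V] (sim : CorrClust.Pair V → ℝ)
        (_ : ∀ e, sim e ∈ Set.Icc (0 : ℝ) 1)
        (ε δ : ℝ) (_ : 0 < ε) (_ : ε < 6 * CorrClust.numPairs V) (_ : 0 < δ) (_ : δ < 1)
        (rule : CorrClust.SamplingRule V)
        (Ω : Type v) [MeasurableSpace Ω] (μ : Measure Ω) [IsProbabilityMeasure μ]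
        (X : CorrClust.Pair V → ℕ → Ω → ℝ) (_ : CorrClust.IsNoisyOracle μ sim X),
        ENNReal.ofReal (1 - δ) ≤ μ {ω |
            CorrClust.expectedCost sim (CorrClust.kcfc ε δ rule fun e k => X e k ω) ≤
              5 * CorrClust.OPT sim + ε ∧
            (CorrClust.kcfcQueries ε δ rule fun e k => X e k ω : ℝ≥0∞) ≤
              ENNReal.ofReal
                (K * CorrClust.sampleBound sim (CorrClust.accuracy V ε) δ)} ∧
        ∫⁻ ω, (CorrClust.kcfcQueries ε δ rule fun e k => X e k ω : ℝ≥0∞) ∂μ ≤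
          ENNReal.ofReal
            (K * CorrClust.sampleBound sim (CorrClust.accuracy V ε) δ) := by
  refine ⟨25, by norm_num, ?_⟩
  intro V _ _ sim hsim ε δ hε hε6 hδ hδ1 rule Ω _ μ _ X hX
  -- The range 0 < ε < 6m is empty unless there is at least one pair.
  have hm0 : (0 : ℝ) < CorrClust.numPairs V := by linarith
  have hm : 1 ≤ CorrClust.numPairs V := by exact_mod_cast hm0
  have hη : 0 < CorrClust.accuracy V ε := by
    unfold CorrClust.accuracy
    positivity
  have hη1 : CorrClust.accuracy V ε < 1 / 2 := by
    unfold CorrClust.accuracy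
    rw [div_lt_iff₀ (by positivity)]
    linarith
  refine ⟨(CorrClust.ofReal_one_sub_le_measure hX hδ hδ1 hm).trans (measure_mono fun ω hω => ?_),
    CorrClust.lintegral_tbhsQueries_le hsim hX hη hη1 hδ hδ1 hm rule⟩
  have hT := CorrClust.tbhsQueries_le_of_forall_not_mem_deviation hsim hη hη1 hδ hδ1 hm rule hω
  refine ⟨?_, hT⟩
  -- Finiteness of T comes from the query bound; without it `tbhsGood` would read off the initial
  -- state, since `toNat` sends `⊤` to 0.
  have hfin : CorrClust.tbhsQueries (CorrClust.accuracy V ε) δ rule (fun e k => X e k ω) ≠ ⊤ := by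
    intro h
    rw [h] at hT
    exact ENNReal.ofReal_ne_top (top_le_iff.1 hT)
  obtain ⟨hG, hB⟩ := CorrClust.tbhsGood_correct _ δ rule _ sim hfin fun e k hk => by
    obtain ⟨k, rfl⟩ := Nat.exists_eq_add_of_le' hk
    exact not_le.1 (hω e k)
  refine (CorrClust.expectedCost_kwikCluster_le sim hsim _ hη.le _ hG hB).trans ?_
  have : 8 * CorrClust.numPairs V * CorrClust.accuracy V ε = 2 / 3 * ε := by
    unfold CorrClust.accuracy
    field_simp
    norm_num
  rw [this]
  linarith
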